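/- Graphs may have loops and multiple edges, and every edge has length $1$. Covering maps are surjective, send vertices to vertices, and restrict to a bijection from the set of oriented edges issuing from each vertex to the set of those issuing from its image. A covering map from a connected graph is regular if its group of deck transformations acts transitively on every fibre. A quasitree is a connected graph that is quasi-isometric to a tree. For a locally finite graph $X$, the group $\mathrm{Aut}(X)$ carries the compact-open topology, and a uniform lattice in $\mathrm{Aut}(X)$ is a discrete subgroup that acts properly and cocompactly on $X$. **Theorem.** There exist a locally finite quasitree $X$, finite graphs $X_1$ and $X_2$, a covering map $X\to X_1$, and a regular covering map $X\to X_2$, such that $\mathrm{Aut}(X)$ contains a uniform lattice and such that there is no finite graph $\hat X$ for which there are covering maps $X\to\hat X$, $\hat X\to X_1$ and $\hat X\to X_2$. (The covering maps through $\hat X$ are arbitrary: their compositions are not required to be the given maps $X\to X_1$ and $X\to X_2$.) -/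

import Mathlib

/-- A graph in the sense of Serre (loops and multiple edges are allowed).  `D` is the set `E^±` of
oriented edges, `src` is the initial vertex of an oriented edge, and `inv` reverses the orientation;
a geometric edge is a pair `{d, inv d}`.  -/
structure SerreGraph where
  /-- vertices -/
  V : Type
  /-- oriented edges -/
  D : Type
  /-- initial vertex -/
  src : D → V
  /-- the same edge with the opposite orientation -/
  inv : D → D
  inv_inv : ∀ d, inv (inv d) = d
  inv_ne : ∀ d, inv d ≠ d

namespace SerreGraph

/-- The terminal vertex of an oriented edge. -/
def tgt (X : SerreGraph) (d : X.D) : X.V := X.src (X.inv d)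

/-- The set of oriented edges with initial vertex `v`. -/
def star (X : SerreGraph) (v : X.V) : Set X.D := {d | X.src d = v}

/-- A graph is finite if it has finitely many vertices and edges. -/
def IsFinite (X : SerreGraph) : Prop := Finite X.V ∧ Finite X.D

/-- A graph is locally finite if each vertex has finite valence. -/
def IsLocallyFinite (X : SerreGraph) : Prop := ∀ v, (X.star v).Finite

/-- The adjacency relation of distinct vertices, as a simple graph (forgetting loops and
multiplicities of edges).  It has the same connected components and the same path metric on vertices
as `X`. -/
def toSimpleGraph (X : SerreGraph) : SimpleGraph X.V :=
  SimpleGraph.fromRel fun v w => ∃ d, X.src d = v ∧ X.tgt d = w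

/-- Connected (and non-empty) graphs. -/
def IsConnected (X : SerreGraph) : Prop := X.toSimpleGraph.Connected

/-- The path metric on the vertices (meaningful when `X` is connected). -/
noncomputable def dist (X : SerreGraph) (v w : X.V) : ℕ := X.toSimpleGraph.dist v w

/-- A quasitree: a connected graph which is quasi-isometric to a tree (as all edges have length one,
quasi-isometries may be taken between the vertex sets with their path metrics). -/
def IsQuasitree (X : SerreGraph) : Prop :=
  X.IsConnected ∧
    ∃ (W : Type) (T : SimpleGraph W), T.IsTree ∧
      ∃ (f : X.V → W) (K C : ℝ), 1 ≤ K ∧ 0 ≤ C ∧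
        (∀ v w, K⁻¹ * (X.dist v w : ℝ) - C ≤ (T.dist (f v) (f w) : ℝ) ∧
          (T.dist (f v) (f w) : ℝ) ≤ K * (X.dist v w : ℝ) + C) ∧
        ∀ t, ∃ v, (T.dist (f v) t : ℝ) ≤ C

/-- Graph morphisms: vertices go to vertices and edges to edges. -/
structure Hom (X Y : SerreGraph) where
  onV : X.V → Y.V
  onD : X.D → Y.D
  src_onD : ∀ d, Y.src (onD d) = onV (X.src d)
  inv_onD : ∀ d, Y.inv (onD d) = onD (X.inv d)

/-- A covering map: a surjective morphism that is a bijection from the star of each vertex onto the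
star of its image. -/
def Hom.IsCovering {X Y : SerreGraph} (p : Hom X Y) : Prop :=
  Function.Surjective p.onV ∧ ∀ v, Set.BijOn p.onD (X.star v) (Y.star (p.onV v))

/-- `X` covers `Y`. -/
def Covers (X Y : SerreGraph) : Prop := ∃ p : Hom X Y, p.IsCovering

/-- The automorphism group of `X`, as a group of pairs of a permutation of the vertices and a
permutation of the oriented edges. -/
def Aut (X : SerreGraph) : Subgroup (Equiv.Perm X.V × Equiv.Perm X.D) where
  carrier := {g | (∀ d, X.src (g.2 d) = g.1 (X.src d)) ∧ ∀ d, X.inv (g.2 d) = g.2 (X.inv d)}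
  one_mem' := by simp
  mul_mem' := by
    rintro a b ⟨ha, ha'⟩ ⟨hb, hb'⟩
    simp [ha, ha', hb, hb']
  inv_mem' := by
    rintro a ⟨ha, ha'⟩
    refine ⟨fun d => ?_, fun d => ?_⟩
    · have h := ha (a.2.symm d)
      rw [Equiv.apply_symm_apply] at h
      change X.src (a.2.symm d) = a.1.symm (X.src d)
      rw [h, Equiv.symm_apply_apply]
    · have h := ha' (a.2.symm d)
      rw [Equiv.apply_symm_apply] at h
      change X.inv (a.2.symm d) = a.2.symm (X.inv d)
      rw [h, Equiv.symm_apply_apply]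

/-- The compact-open topology on the automorphism group: the topology of pointwise convergence on
the discrete sets of vertices and oriented edges. -/
abbrev autTopology (X : SerreGraph) : TopologicalSpace X.Aut :=
  letI : TopologicalSpace X.V := ⊥
  letI : TopologicalSpace X.D := ⊥
  TopologicalSpace.induced
    (fun g => ((g.1.1 : X.V → X.V), (g.1.2 : X.D → X.D))) inferInstance

/-- A uniform lattice in `Aut X`: a discrete subgroup that acts properly and cocompactly on the
(locally finite) graph `X`.  A compact subset of the locally finite graph `X` lies in a finite
subgraph, so properness is finiteness of the set of elements that do not move a given finite set of
vertices off itself, and cocompactness is the existence of finitely many vertices and edges whose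
translates exhaust `X`. -/
def IsUniformLattice (X : SerreGraph) (Γ : Subgroup X.Aut) : Prop :=
  (letI := X.autTopology; DiscreteTopology Γ) ∧
  (∀ S : Set X.V, S.Finite → {g : X.Aut | g ∈ Γ ∧ (g.1.1 '' S ∩ S).Nonempty}.Finite) ∧
  (∃ S : Set X.V, S.Finite ∧ ∀ v, ∃ g ∈ Γ, ∃ s ∈ S, g.1.1 s = v) ∧
  ∃ E : Set X.D, E.Finite ∧ ∀ d, ∃ g ∈ Γ, ∃ e ∈ E, g.1.2 e = d

/-- A deck transformation (element of the Galois group) of a morphism. -/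
def Hom.IsDeck {X Y : SerreGraph} (p : Hom X Y) (g : X.Aut) : Prop :=
  (∀ v, p.onV (g.1.1 v) = p.onV v) ∧ ∀ d, p.onD (g.1.2 d) = p.onD d

/-- A regular covering (of a connected graph): the group of deck transformations acts transitively
on each fibre. -/
def Hom.IsRegularCovering {X Y : SerreGraph} (p : Hom X Y) : Prop :=
  p.IsCovering ∧ ∀ v w, p.onV v = p.onV w → ∃ g : X.Aut, p.IsDeck g ∧ g.1.1 v = w

end SerreGraph

/-!
The graph `X` is a tree of triangles: the Cayley graph of `C₃ * C₂ * C₂ * C₂`, in which every vertex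
lies on one triangle and on three further edges, the bridges.  It covers regularly the triangular
prism with tripled vertical edges, the Cayley graph of the quotient `C₃ × C₂`.

The other quotient `X₁` has two inner vertices, each carrying a loop, and two outer vertices; there
are three spokes from each inner vertex to an outer vertex of its own, and two edges join the outer
vertices.  A closed walk of length three in `X₁` meets at most one outer vertex.  In a common finite
cover the lifts of a spoke match outer with inner vertices, so half of all vertices are outer, while
the lifts of the triangles of the prism partition the vertices into closed walks of length three, so
at most a third of them are outer.  In `X` there is no such conflict: a covering `X → X₁` is built
by choosing at each bridge any local picture of `X₁` that fits, which is an action of the free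
product on infinitely many copies of the finitely many local pictures.
-/

namespace SerreGraph

open Monoid Equiv

/-! ### Graphs and coverings -/

section Coverings

variable {X Y Z : SerreGraph}

theorem toSimpleGraph_adj_iff {v w : X.V} :
    X.toSimpleGraph.Adj v w ↔ v ≠ w ∧ ∃ d, X.src d = v ∧ X.tgt d = w := by
  refine (SimpleGraph.fromRel_adj _ _ _).trans (and_congr_right fun _ => ⟨?_, Or.inl⟩)
  rintro (h | ⟨d, rfl, rfl⟩)
  · exact h
  · exact ⟨X.inv d, rfl, congrArg X.src (X.inv_inv d)⟩

theorem reachable_src_tgt (d : X.D) : X.toSimpleGraph.Reachable (X.src d) (X.tgt d) := by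
  by_cases h : X.src d = X.tgt d
  · rw [h]
  · exact (toSimpleGraph_adj_iff.2 ⟨h, d, rfl, rfl⟩).reachable

theorem Hom.tgt_onD (p : Hom X Y) (d : X.D) : Y.tgt (p.onD d) = p.onV (X.tgt d) := by
  rw [tgt, p.inv_onD, p.src_onD, tgt]

theorem Hom.isCovering_of_bijOn_star [hX : Nonempty X.V] (hY : Y.IsConnected) {p : Hom X Y}
    (hp : ∀ v, Set.BijOn p.onD (X.star v) (Y.star (p.onV v))) : p.IsCovering := by
  obtain ⟨x₀⟩ := hX
  refine ⟨fun w => ?_, hp⟩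
  have hw := (SimpleGraph.reachable_iff_reflTransGen _ _).1 (hY.preconnected (p.onV x₀) w)
  induction hw with
  | refl => exact ⟨x₀, rfl⟩
  | tail _ hadj ih =>
    obtain ⟨x, rfl⟩ := ih
    obtain ⟨-, d, hd, rfl⟩ := toSimpleGraph_adj_iff.1 hadj
    obtain ⟨e, -, rfl⟩ := (hp x).surjOn hd
    exact ⟨X.tgt e, (p.tgt_onD e).symm⟩

/-- Edges `δ v` issuing from the vertices `v` that end at each vertex exactly once decompose the
vertices into cycles, and so do their lifts. -/
theorem Hom.IsCovering.exists_perm_lift {q : Hom Y Z} (hq : q.IsCovering) {δ : Z.V → Z.D}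
    (hsrc : ∀ v, Z.src (δ v) = v) (htgt : Function.Bijective fun v => Z.tgt (δ v)) :
    ∃ ρ : Perm Y.V, ∀ e, q.onD e = δ (q.onV (Y.src e)) → ρ (Y.src e) = Y.tgt e := by
  choose lift lift_src onD_lift using fun y => (hq.2 y).surjOn (hsrc (q.onV y))
  have tgt_lift (y) : q.onV (Y.tgt (lift y)) = Z.tgt (δ (q.onV y)) := by
    rw [← q.tgt_onD, onD_lift]
  have lift_unique (e) (he : q.onD e = δ (q.onV (Y.src e))) : lift (Y.src e) = e :=
    (hq.2 (Y.src e)).injOn (lift_src _) rfl ((onD_lift _).trans he.symm)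
  refine ⟨Equiv.ofBijective (fun y => Y.tgt (lift y)) ⟨fun y y' h => ?_, fun y => ?_⟩,
    fun e he => congrArg Y.tgt (lift_unique e he)⟩
  · have hqy : q.onV y = q.onV y' := htgt.1 (by
      simpa only [tgt_lift] using congrArg q.onV h)
    have hinv : Y.inv (lift y) = Y.inv (lift y') :=
      (hq.2 (Y.tgt (lift y))).injOn rfl h.symm (by
        rw [← q.inv_onD, ← q.inv_onD, onD_lift, onD_lift, hqy])
    have hlift : lift y = lift y' := by rw [← Y.inv_inv (lift y), hinv, Y.inv_inv]
    exact (lift_src y).symm.trans ((congrArg Y.src hlift).trans (lift_src y'))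
  · obtain ⟨v, hv⟩ := htgt.2 (q.onV y)
    obtain ⟨e, rfl, hqe⟩ := (hq.2 y).surjOn hv
    have hqinv : q.onD (Y.inv e) = δ v := by rw [← q.inv_onD, hqe, Z.inv_inv]
    have hqsrc : q.onV (Y.src (Y.inv e)) = v := by rw [← q.src_onD, hqinv, hsrc]
    refine ⟨Y.src (Y.inv e), ?_⟩
    change Y.tgt (lift _) = _
    rw [lift_unique (Y.inv e) (by rw [hqinv, hqsrc]), tgt, Y.inv_inv]

theorem discreteTopology_of_injOn_apply {Γ : Subgroup X.Aut} (v : X.V)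
    (hv : Set.InjOn (fun g : X.Aut => g.1.1 v) Γ) :
    letI := X.autTopology
    DiscreteTopology Γ := by
  let _ : TopologicalSpace X.V := ⊥
  let _ : TopologicalSpace X.D := ⊥
  let _ := X.autTopology
  have : DiscreteTopology X.V := ⟨rfl⟩
  have hind : Continuous fun g : X.Aut => ((g.1.1 : X.V → X.V), (g.1.2 : X.D → X.D)) :=
    continuous_induced_dom
  have hcont : Continuous fun g : Γ => g.1.1.1 v :=
    (continuous_apply v).comp (continuous_fst.comp (hind.comp continuous_subtype_val))
  exact .of_continuous_injective hcont (Set.injOn_iff_injective.1 hv)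

theorem isQuasitree_of_isTree_le {T : SimpleGraph X.V} (hT : T.IsTree) (hle : T ≤ X.toSimpleGraph)
    (K : ℕ) (hK : ∀ d, T.dist (X.src d) (X.tgt d) ≤ K) : X.IsQuasitree := by
  have hconn : X.toSimpleGraph.Connected := hT.connected.mono hle
  have dist_le (v w) : X.dist v w ≤ T.dist v w := (hT.connected v w).dist_anti hle
  have le_dist (v w) : T.dist v w ≤ K * X.dist v w := by
    obtain ⟨p, hp⟩ := hconn.exists_walk_length_eq_dist v w
    rw [dist, ← hp]
    clear hp
    induction p with
    | nil => simp only [SimpleGraph.dist_self, Nat.zero_le]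
    | @cons u v w huv p ih =>
      obtain ⟨-, d, rfl, rfl⟩ := toSimpleGraph_adj_iff.1 huv
      calc T.dist (X.src d) w ≤ T.dist (X.src d) (X.tgt d) + T.dist (X.tgt d) w :=
            hT.connected.dist_triangle
        _ ≤ K + K * p.length := add_le_add (hK d) ih
        _ = K * (SimpleGraph.Walk.cons huv p).length := by
            rw [SimpleGraph.Walk.length_cons]; ring
  refine ⟨hconn, X.V, T, hT, id, K + 1, 0, by simp, le_rfl, fun v w => ⟨?_, ?_⟩, fun t => ⟨t, ?_⟩⟩
  · have h : (X.dist v w : ℝ) ≤ T.dist v w := mod_cast dist_le v w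
    have hinv : ((K : ℝ) + 1)⁻¹ ≤ 1 := inv_le_one_of_one_le₀ (by simp)
    rw [sub_zero]
    exact (mul_le_of_le_one_left (Nat.cast_nonneg _) hinv).trans h
  · have h : (T.dist v w : ℝ) ≤ K * X.dist v w := mod_cast le_dist v w
    simp only [id]
    linarith [(Nat.cast_nonneg _ : (0 : ℝ) ≤ X.dist v w)]
  · simp only [id, SimpleGraph.dist_self, Nat.cast_zero, le_refl]

end Coverings

/-! ### Rooted trees and free products -/

section ParentGraph

variable {V : Type*} {π : V → V}

/-- The simple graph in which each vertex is joined to its parent; a root is its own parent. -/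
def parentGraph (π : V → V) : SimpleGraph V :=
  SimpleGraph.fromRel fun v w => π w = v

theorem parentGraph_adj_iff {v w : V} :
    (parentGraph π).Adj v w ↔ v ≠ w ∧ (π w = v ∨ π v = w) :=
  SimpleGraph.fromRel_adj _ _ _

theorem dist_parent_le_one (v : V) : (parentGraph π).dist v (π v) ≤ 1 := by
  by_cases h : v = π v
  · rw [← h, SimpleGraph.dist_self]
    exact zero_le_one
  · exact (SimpleGraph.dist_eq_one_iff_adj.2 (parentGraph_adj_iff.2 ⟨h, Or.inr rfl⟩)).le

variable {depth : V → ℕ} {o : V}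

theorem parentGraph_connected (hπ : ∀ v, v ≠ o → depth (π v) < depth v) :
    (parentGraph π).Connected := by
  refine (SimpleGraph.connected_iff_exists_forall_reachable _).2 ⟨o, fun v => ?_⟩
  induction hn : depth v using Nat.strong_induction_on generalizing v with
  | _ n ih =>
    by_cases hv : v = o
    · rw [hv]
    · have hlt := hπ v hv
      have hadj : (parentGraph π).Adj (π v) v :=
        parentGraph_adj_iff.2 ⟨fun h => hlt.ne (congrArg depth h), Or.inl rfl⟩
      exact (ih _ (hn ▸ hlt) (π v) rfl).trans hadj.reachable

theorem eq_parent_of_adj_of_depth_le (ho : π o = o) (hπ : ∀ v, v ≠ o → depth (π v) < depth v)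
    {v w : V} (h : (parentGraph π).Adj v w) (hle : depth w ≤ depth v) : w = π v := by
  obtain ⟨hne, rfl | rfl⟩ := parentGraph_adj_iff.1 h
  · have hw : w ≠ o := by
      rintro rfl
      exact hne ho
    exact absurd (hπ w hw) hle.not_gt
  · rfl

/-- Both neighbours of a deepest vertex on a cycle would be its parent. -/
theorem parentGraph_isTree (ho : π o = o) (hπ : ∀ v, v ≠ o → depth (π v) < depth v) :
    (parentGraph π).IsTree := by
  classical
  refine ⟨parentGraph_connected hπ, fun u c hc => ?_⟩
  obtain ⟨v, hv, hmax⟩ := c.support.toFinset.exists_max_image depth ⟨u, by simp⟩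
  rw [List.mem_toFinset] at hv
  have eq_parent {w} (h : (parentGraph π).Adj v w) (hw : w ∈ (c.rotate v hv).support) : w = π v :=
    eq_parent_of_adj_of_depth_le ho hπ h
      (hmax w (List.mem_toFinset.2 ((c.mem_support_rotate_iff v hv).1 hw)))
  have hcycle := hc.rotate hv
  refine hcycle.snd_ne_penultimate ?_
  rw [eq_parent (SimpleGraph.Walk.adj_snd hcycle.not_nil)
      (SimpleGraph.Walk.getVert_mem_support _ _),
    eq_parent (SimpleGraph.Walk.adj_penultimate hcycle.not_nil).symm
      (SimpleGraph.Walk.getVert_mem_support _ _)]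

end ParentGraph

section FreeProduct

variable {ι : Type*} {M : ι → Type*} [∀ i, Monoid (M i)]

theorem exists_eq_of_mul_prod {g : CoprodI M} (hg : g ≠ 1) :
    ∃ (i : ι) (m : M i) (w : CoprodI.Word M),
      w.fstIdx ≠ some i ∧ m ≠ 1 ∧ g = CoprodI.of m * w.prod := by
  classical
  have hprod : (CoprodI.Word.equiv g).prod = g := CoprodI.Word.equiv.left_inv g
  generalize CoprodI.Word.equiv g = u at hprod
  induction u using CoprodI.Word.consRecOn with
  | empty => exact absurd hprod.symm hg
  | cons i m w hw hm => exact ⟨i, m, w, hw, hm, by rw [← hprod, CoprodI.Word.prod_cons]⟩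

variable [DecidableEq ι] [∀ i, DecidableEq (M i)]

/-- The element of a free product whose reduced word is obtained by deleting the first letter;
it is `1` for `1`. -/
def dropFirstLetter (g : CoprodI M) : CoprodI M :=
  CoprodI.Word.prod
    { toList := (CoprodI.Word.equiv g).toList.tail
      ne_one := fun l hl => (CoprodI.Word.equiv g).ne_one l (List.mem_of_mem_tail hl)
      chain_ne := (CoprodI.Word.equiv g).chain_ne.tail }

/-- The number of letters of the reduced word of an element of a free product. -/
def wordLength (g : CoprodI M) : ℕ := (CoprodI.Word.equiv g).toList.length

theorem wordEquiv_prod (w : CoprodI.Word M) : CoprodI.Word.equiv w.prod = w :=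
  CoprodI.Word.equiv.right_inv w

theorem dropFirstLetter_one : dropFirstLetter (1 : CoprodI M) = 1 := by
  have h : CoprodI.Word.equiv (1 : CoprodI M) = CoprodI.Word.empty :=
    wordEquiv_prod CoprodI.Word.empty
  simp only [dropFirstLetter, h]
  rfl

variable {i : ι} {m : M i} {w : CoprodI.Word M}

theorem wordEquiv_of_mul_prod (hw : w.fstIdx ≠ some i) (hm : m ≠ 1) :
    CoprodI.Word.equiv (CoprodI.of m * w.prod) = CoprodI.Word.cons m w hw hm := by
  rw [← CoprodI.Word.prod_cons i m w hm hw, wordEquiv_prod]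

theorem dropFirstLetter_of_mul_prod (hw : w.fstIdx ≠ some i) (hm : m ≠ 1) :
    dropFirstLetter (CoprodI.of m * w.prod) = w.prod := by
  simp only [dropFirstLetter, wordEquiv_of_mul_prod hw hm]
  rfl

theorem wordLength_of_mul_prod (hw : w.fstIdx ≠ some i) (hm : m ≠ 1) :
    wordLength (CoprodI.of m * w.prod) = wordLength w.prod + 1 := by
  simp only [wordLength, wordEquiv_of_mul_prod hw hm, wordEquiv_prod]
  rfl

theorem wordLength_dropFirstLetter_lt {g : CoprodI M} (hg : g ≠ 1) :
    wordLength (dropFirstLetter g) < wordLength g := by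
  obtain ⟨i, m, w, hw, hm, rfl⟩ := exists_eq_of_mul_prod hg
  rw [dropFirstLetter_of_mul_prod hw hm, wordLength_of_mul_prod hw hm]
  exact Nat.lt_succ_self _

theorem dropFirstLetter_of_mul (m : M i) (g : CoprodI M) :
    dropFirstLetter (CoprodI.of m * g) = g ∨ dropFirstLetter g = CoprodI.of m * g ∨
      dropFirstLetter (CoprodI.of m * g) = dropFirstLetter g := by
  obtain ⟨⟨a, w, hw⟩, rfl⟩ : ∃ p : CoprodI.Word.Pair M i, g = CoprodI.of p.head * p.tail.prod :=
    ⟨CoprodI.Word.equivPair i (CoprodI.Word.equiv g), by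
      rw [← CoprodI.Word.prod_rcons, ← CoprodI.Word.equivPair_symm, symm_apply_apply]
      exact (CoprodI.Word.equiv.left_inv g).symm⟩
  simp only [← mul_assoc, ← map_mul]
  by_cases ha : a = 1 <;> by_cases hma : m * a = 1
  · rw [hma, ha]
    exact Or.inr (Or.inr rfl)
  · rw [dropFirstLetter_of_mul_prod hw hma, ha, map_one, one_mul]
    exact Or.inl rfl
  · rw [dropFirstLetter_of_mul_prod hw ha, hma, map_one, one_mul]
    exact Or.inr (Or.inl rfl)
  · rw [dropFirstLetter_of_mul_prod hw ha, dropFirstLetter_of_mul_prod hw hma]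
    exact Or.inr (Or.inr rfl)

/-- The tree on a free product in which deleting the first letter leads towards the root `1`. -/
def wordTree (M : ι → Type*) [∀ i, Monoid (M i)] [∀ i, DecidableEq (M i)] :
    SimpleGraph (CoprodI M) :=
  parentGraph dropFirstLetter

theorem wordTree_isTree : (wordTree M).IsTree :=
  parentGraph_isTree dropFirstLetter_one fun _ => wordLength_dropFirstLetter_lt

theorem wordTree_dist_of_mul_le_two (m : M i) (g : CoprodI M) :
    (wordTree M).dist g (CoprodI.of m * g) ≤ 2 := by
  have hg : (wordTree M).dist g (dropFirstLetter g) ≤ 1 := dist_parent_le_one g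
  have hmg : (wordTree M).dist (dropFirstLetter (CoprodI.of m * g)) (CoprodI.of m * g) ≤ 1 := by
    rw [SimpleGraph.dist_comm]
    exact dist_parent_le_one _
  rcases dropFirstLetter_of_mul m g with h | h | h
  · rw [h] at hmg
    exact hmg.trans one_le_two
  · rw [h] at hg
    exact hg.trans one_le_two
  · rw [h] at hmg
    exact wordTree_isTree.connected.dist_triangle.trans (add_le_add hg hmg)

end FreeProduct

/-! ### Cayley graphs -/

/-- A family of nontrivial elements of a group that is closed under inversion, to serve as the edge
labels of a Cayley graph.  The inverse label is a datum because elements may be repeated. -/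
structure SymmetricFamily (G L : Type) [Group G] where
  elt : L → G
  rev : L → L
  rev_rev : ∀ l, rev (rev l) = l
  elt_rev : ∀ l, elt (rev l) = (elt l)⁻¹
  elt_ne_one : ∀ l, elt l ≠ 1

/-- The image of a symmetric family under a homomorphism, with the same labels. -/
def SymmetricFamily.map {G N L : Type} [Group G] [Group N] (A : SymmetricFamily G L) (φ : G →* N)
    (hφ : ∀ l, φ (A.elt l) ≠ 1) : SymmetricFamily N L where
  elt l := φ (A.elt l)
  rev := A.rev
  rev_rev := A.rev_rev
  elt_rev l := by rw [A.elt_rev, map_inv]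
  elt_ne_one := hφ

/-- The Cayley graph of a symmetric family, with an edge labelled `l` from `g` to `A.elt l * g`, so
that the group acts by right multiplication. -/
abbrev cayley {G L : Type} [Group G] (A : SymmetricFamily G L) : SerreGraph where
  V := G
  D := G × L
  src := Prod.fst
  inv d := (A.elt d.2 * d.1, A.rev d.2)
  inv_inv d := by simp only [A.elt_rev, A.rev_rev, inv_mul_cancel_left]
  inv_ne d h := A.elt_ne_one d.2 (mul_eq_right.1 (congrArg Prod.fst h))

section Cayley

variable {G L : Type} [Group G] (A : SymmetricFamily G L)

theorem bijOn_star_cayley {D : Type} {g : G} {f : G × L → D} {s : Set D}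
    (hf : Set.BijOn (fun l => f (g, l)) Set.univ s) : Set.BijOn f ((cayley A).star g) s := by
  refine ⟨?_, ?_, fun d hd => ?_⟩
  · rintro ⟨_, l⟩ rfl
    exact hf.mapsTo (Set.mem_univ l)
  · rintro ⟨_, l⟩ rfl ⟨_, l'⟩ rfl h
    rw [hf.injOn (Set.mem_univ l) (Set.mem_univ l') h]
  · obtain ⟨l, -, rfl⟩ := hf.surjOn hd
    exact ⟨(g, l), rfl, rfl⟩

theorem cayley_isLocallyFinite [Finite L] : (cayley A).IsLocallyFinite := by
  refine fun g => (Set.finite_range fun l : L => (g, l)).subset ?_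
  rintro ⟨_, l⟩ rfl
  exact ⟨l, rfl⟩

theorem cayley_isFinite [Finite G] [Finite L] : (cayley A).IsFinite :=
  ⟨inferInstanceAs (Finite G), inferInstanceAs (Finite (G × L))⟩

/-- The action of a group on its Cayley graph, in which `h` acts as right multiplication by
`h⁻¹`. -/
def cayleyAction : G →* (cayley A).Aut where
  toFun h := ⟨(Equiv.mulRight h⁻¹, (Equiv.mulRight h⁻¹).prodCongr (Equiv.refl L)),
    fun _ => rfl, fun d => Prod.ext (mul_assoc (A.elt d.2) d.1 h⁻¹).symm rfl⟩
  map_one' := by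
    refine Subtype.ext (Prod.ext (Equiv.ext fun g => ?_) (Equiv.ext fun d => Prod.ext ?_ rfl)) <;>
    simp
  map_mul' h k := by
    refine Subtype.ext (Prod.ext (Equiv.ext fun g => ?_) (Equiv.ext fun d => Prod.ext ?_ rfl)) <;>
    simp [mul_assoc]

theorem cayleyAction_isUniformLattice [Finite L] :
    (cayley A).IsUniformLattice (cayleyAction A).range := by
  refine ⟨discreteTopology_of_injOn_apply (1 : G) ?_, fun S hS => ?_,
    ⟨{(1 : G)}, Set.finite_singleton _, fun v => ⟨_, ⟨v⁻¹, rfl⟩, (1 : G), rfl, ?_⟩⟩,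
    ⟨Set.range fun l => ((1 : G), l), Set.finite_range _, fun d =>
      ⟨_, ⟨d.1⁻¹, rfl⟩, (1, d.2), ⟨d.2, rfl⟩, Prod.ext ?_ rfl⟩⟩⟩
  · rintro _ ⟨h, rfl⟩ _ ⟨k, rfl⟩ (hhk : 1 * h⁻¹ = 1 * k⁻¹)
    rw [_root_.inv_injective (mul_left_cancel hhk)]
  · refine ((hS.prod hS).image fun q : G × G => cayleyAction A (q.2⁻¹ * q.1)).subset ?_
    rintro _ ⟨⟨h, rfl⟩, _, ⟨v, hv, rfl⟩, hw⟩
    refine ⟨(v, v * h⁻¹), ⟨hv, hw⟩, congrArg _ ?_⟩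
    group
  · change 1 * (v⁻¹)⁻¹ = v
    group
  · change 1 * (d.1⁻¹)⁻¹ = d.1
    group

/-- The morphism of Cayley graphs induced by a group homomorphism. -/
def cayleyMap {N : Type} [Group N] (φ : G →* N) (hφ : ∀ l, φ (A.elt l) ≠ 1) :
    Hom (cayley A) (cayley (A.map φ hφ)) where
  onV := φ
  onD d := (φ d.1, d.2)
  src_onD _ := rfl
  inv_onD d := Prod.ext (map_mul φ (A.elt d.2) d.1).symm rfl

theorem cayleyMap_isRegularCovering {N : Type} [Group N] {φ : G →* N}
    (hφ : ∀ l, φ (A.elt l) ≠ 1) (hsurj : Function.Surjective φ) :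
    (cayleyMap A φ hφ).IsRegularCovering := by
  refine ⟨⟨hsurj, fun g => bijOn_star_cayley A ⟨fun l _ => rfl, ?_, ?_⟩⟩, fun v w hvw =>
    ⟨cayleyAction A (w⁻¹ * v), ?_, ?_⟩⟩
  · exact fun l _ l' _ h => (Prod.ext_iff.1 h).2
  · rintro ⟨_, l⟩ rfl
    exact ⟨l, Set.mem_univ l, rfl⟩
  · have hker : φ (w⁻¹ * v) = 1 := by
      rw [map_mul, map_inv, inv_mul_eq_one]
      exact hvw.symm
    have fibre (u : G) : φ (u * (w⁻¹ * v)⁻¹) = φ u := by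
      rw [map_mul, map_inv, hker, inv_one, mul_one]
    exact ⟨fibre, fun d => Prod.ext (fibre d.1) rfl⟩
  · change v * (w⁻¹ * v)⁻¹ = w
    group

theorem cayley_isQuasitree {ι : Type} {M : ι → Type} [∀ i, Group (M i)]
    (A : SymmetricFamily (CoprodI M) L) (hletter : ∀ l, ∃ (i : ι) (m : M i), CoprodI.of m = A.elt l)
    (hall : ∀ (i : ι) (m : M i), m ≠ 1 → CoprodI.of m ∈ Set.range A.elt) :
    (cayley A).IsQuasitree := by
  classical
  have adj_parent (g : CoprodI M) (hg : dropFirstLetter g ≠ g) :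
      (cayley A).toSimpleGraph.Adj (dropFirstLetter g) g := by
    have hg₁ : g ≠ 1 := by
      rintro rfl
      exact hg dropFirstLetter_one
    obtain ⟨i, m, w, hw, hm, rfl⟩ := exists_eq_of_mul_prod hg₁
    rw [dropFirstLetter_of_mul_prod hw hm] at hg ⊢
    obtain ⟨l, hl⟩ := hall i m hm
    exact toSimpleGraph_adj_iff.2 ⟨hg, (w.prod, l), rfl, congrArg (· * w.prod) hl⟩
  refine isQuasitree_of_isTree_le (wordTree_isTree (M := M)) (fun v w hvw => ?_) 2 ?_
  · obtain ⟨hne, rfl | rfl⟩ := parentGraph_adj_iff.1 hvw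
    · exact adj_parent w hne
    · exact (adj_parent v hne.symm).symm
  · rintro ⟨g, l⟩
    obtain ⟨i, m, hm⟩ := hletter l
    change (wordTree M).dist g (A.elt l * g) ≤ 2
    rw [← hm]
    exact wordTree_dist_of_mul_le_two m g

end Cayley

/-! ### Coverings by Cayley graphs -/

/-- A framing of `Z` by labels `L`: frames `x : F`, each of which matches the labels with the
oriented edges issuing from a vertex.  Frames record the possible local pictures of a covering of
`Z` by a graph with labelled edges; a vertex may have many frames or none. -/
structure Framing (Z : SerreGraph) (L F : Type) where
  vertex : F → Z.V
  edge : F → L → Z.D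
  bijOn_edge : ∀ x, Set.BijOn (edge x) Set.univ (Z.star (vertex x))

section Framing

variable {Z : SerreGraph} {G L F S : Type} [Group G]

/-- The framing with a frame for each `s : S`, which is a copy of the frame `f s`. -/
def Framing.comap (P : Framing Z L F) (f : S → F) : Framing Z L S where
  vertex s := P.vertex (f s)
  edge s := P.edge (f s)
  bijOn_edge s := P.bijOn_edge (f s)

theorem Framing.exists_isCovering_cayley (P : Framing Z L F) (hZ : Z.IsConnected)
    (A : SymmetricFamily G L) (φ : G →* Perm F)
    (hφ : ∀ x l, Z.inv (P.edge x l) = P.edge (φ (A.elt l) x) (A.rev l)) (x₀ : F) :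
    ∃ p : Hom (cayley A) Z, p.IsCovering := by
  let p : Hom (cayley A) Z :=
    { onV := fun g => P.vertex (φ g x₀)
      onD := fun d => P.edge (φ d.1 x₀) d.2
      src_onD := fun d => (P.bijOn_edge _).mapsTo (Set.mem_univ d.2)
      inv_onD := fun d => by rw [hφ, map_mul, Perm.mul_apply] }
  have : Nonempty (cayley A).V := ⟨(1 : G)⟩
  exact ⟨p, p.isCovering_of_bijOn_star hZ fun g => bijOn_star_cayley A (P.bijOn_edge (φ g x₀))⟩

/-- With infinitely many copies of each point, all fibres of a surjection have the same size, so
they can be interchanged. -/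
theorem exists_involution_lift {D : Type} [Countable F] {f : F → D} (hf : Function.Surjective f)
    {τ : D → D} (hτ : Function.Involutive τ) :
    ∃ σ : Perm (F × ℕ), σ ^ 2 = 1 ∧ ∀ x, f (σ x).1 = τ (f x.1) := by
  have fibre_equiv (d : D) : Nonempty ({x : F × ℕ // f x.1 = d} ≃ ℕ) := by
    obtain ⟨x, hx⟩ := hf d
    have : Infinite {x : F × ℕ // f x.1 = d} :=
      Infinite.of_injective (fun n => ⟨(x, n), hx⟩) fun m n h =>
        (Prod.ext_iff.1 (Subtype.ext_iff.1 h)).2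
    exact nonempty_equiv_of_countable
  let E : F × ℕ ≃ D × ℕ := (sigmaFiberEquiv fun x : F × ℕ => f x.1).symm.trans
    ((sigmaCongrRight fun d => (fibre_equiv d).some).trans (sigmaEquivProd D ℕ))
  have fst_E (x) : (E x).1 = f x.1 := rfl
  refine ⟨E.symm.permCongr (hτ.toPerm.prodCongr (Equiv.refl ℕ)), Equiv.ext fun x => ?_, fun x => ?_⟩
  · have hττ (z : D × ℕ) : Prod.map τ id (Prod.map τ id z) = z := Prod.ext (hτ z.1) rfl
    simp [pow_two, hττ]
  · rw [← fst_E]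
    simp [fst_E]

end Framing

/-! ### The tree of triangles -/

theorem exists_hom_coprodI_zmod {ι H : Type} [Group H] {n : ι → ℕ} {h : ι → H}
    (hh : ∀ i, h i ^ n i = 1) :
    ∃ φ : CoprodI (fun i => Multiplicative (ZMod (n i))) →* H,
      ∀ i, φ (CoprodI.of (Multiplicative.ofAdd (1 : ZMod (n i)))) = h i := by
  have exists_factor (i) : ∃ f : Multiplicative (ZMod (n i)) →* H,
      f (Multiplicative.ofAdd (1 : ZMod (n i))) = h i := by
    let f : {f : ℤ →+ Additive H // f (n i) = 0} :=
      ⟨zmultiplesHom (Additive H) (Additive.ofMul (h i)), by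
        rw [zmultiplesHom_apply, natCast_zsmul, ← ofMul_pow, hh, ofMul_one]⟩
    refine ⟨AddMonoidHom.toMultiplicativeLeft (ZMod.lift (n i) f), ?_⟩
    have h₁ : ZMod.lift (n i) f 1 = f.1 1 := by simpa using ZMod.lift_coe (n i) f 1
    exact (congrArg Additive.toMul h₁).trans (one_zsmul (Additive.ofMul (h i)))
  choose f hf using exists_factor
  exact ⟨CoprodI.lift f, fun i => (CoprodI.lift_of f _).trans (hf i)⟩

/-- The orders of the cyclic free factors of `TriangleGroup B`. -/
def factorOrder {B : Type} : Option B → ℕ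
  | none => 3
  | some _ => 2

/-- The free product of a cyclic group of order three and cyclic groups of order two indexed by
`B`. -/
abbrev TriangleGroup (B : Type) : Type :=
  CoprodI fun i : Option B => Multiplicative (ZMod (factorOrder i))

section TriangleTree

variable {B : Type}

/-- The generator of a free factor of `TriangleGroup B`. -/
def factorGen (i : Option B) : TriangleGroup B :=
  CoprodI.of (Multiplicative.ofAdd (1 : ZMod (factorOrder i)))

/-- The projection of `TriangleGroup B` to `C₃ × C₂` that identifies all factors of order two. -/
def toPrismGroup : TriangleGroup B →* Multiplicative (ZMod 3 × ZMod 2) :=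
  CoprodI.lift fun
    | none => AddMonoidHom.toMultiplicative (AddMonoidHom.inl (ZMod 3) (ZMod 2))
    | some _ => AddMonoidHom.toMultiplicative (AddMonoidHom.inr (ZMod 3) (ZMod 2))

theorem toPrismGroup_none : toPrismGroup (factorGen (none : Option B)) = .ofAdd (1, 0) :=
  CoprodI.lift_of _ _

theorem toPrismGroup_some (b : B) : toPrismGroup (factorGen (some b)) = .ofAdd (0, 1) :=
  CoprodI.lift_of _ _

theorem factorGen_pow (i : Option B) : factorGen i ^ factorOrder i = 1 := by
  rw [factorGen, ← map_pow, ← ofAdd_nsmul]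
  simp

/-- The labels of the tree of triangles: `inl false` and `inl true` are the generator of order three
and its inverse, `inr b` is the generator of order two with index `b`. -/
def triangleElt : Bool ⊕ B → TriangleGroup B :=
  Sum.elim (fun o => bif o then (factorGen none)⁻¹ else factorGen none) fun b => factorGen (some b)

theorem toPrismGroup_triangleElt (l : Bool ⊕ B) :
    toPrismGroup (triangleElt l) =
      l.elim (fun o => .ofAdd (bif o then 2 else 1, 0)) fun _ => .ofAdd (0, 1) := by
  rcases l with (_ | _) | b
  · exact toPrismGroup_none
  · exact (map_inv _ _).trans (congrArg _ toPrismGroup_none)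
  · exact toPrismGroup_some b

theorem toPrismGroup_triangleElt_ne_one (l : Bool ⊕ B) : toPrismGroup (triangleElt l) ≠ 1 := by
  rw [toPrismGroup_triangleElt]
  rcases l with (_ | _) | b <;> simp only [Sum.elim_inl, Sum.elim_inr] <;> decide

/-- The letters of `TriangleGroup B` as a symmetric family. -/
def triangleFamily (B : Type) : SymmetricFamily (TriangleGroup B) (Bool ⊕ B) where
  elt := triangleElt
  rev := Sum.map not id
  rev_rev := by rintro (_ | _) <;> simp
  elt_rev := by
    rintro ((_ | _) | b)
    · rfl
    · exact (_root_.inv_inv _).symm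
    · exact eq_inv_of_mul_eq_one_left ((pow_two _).symm.trans (factorGen_pow (some b)))
  elt_ne_one l h := toPrismGroup_triangleElt_ne_one l (by rw [h, map_one])

/-- The tree of triangles with bridges labelled by `B` at each vertex. -/
abbrev triangleTree (B : Type) : SerreGraph := cayley (triangleFamily B)

/-- The triangular prism with each vertical edge repeated once for each element of `B`. -/
abbrev prism (B : Type) : SerreGraph :=
  cayley ((triangleFamily B).map toPrismGroup toPrismGroup_triangleElt_ne_one)

theorem triangleTree_isQuasitree : (triangleTree B).IsQuasitree := by
  refine cayley_isQuasitree _ ?_ ?_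
  · rintro ((_ | _) | b)
    · exact ⟨none, _, rfl⟩
    · exact ⟨none, (Multiplicative.ofAdd 1)⁻¹, map_inv _ _⟩
    · exact ⟨some b, _, rfl⟩
  · have order_three : ∀ m : Multiplicative (ZMod 3), m ≠ 1 →
        m = Multiplicative.ofAdd 1 ∨ m = (Multiplicative.ofAdd 1)⁻¹ := by decide
    have order_two : ∀ m : Multiplicative (ZMod 2), m ≠ 1 → m = Multiplicative.ofAdd 1 := by decide
    rintro (_ | b) m hm
    · rcases order_three m hm with rfl | rfl
      · exact ⟨Sum.inl false, rfl⟩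
      · exact ⟨Sum.inl true, (map_inv _ _).symm⟩
    · obtain rfl := order_two m hm
      exact ⟨Sum.inr b, rfl⟩

theorem toPrismGroup_surjective [hB : Nonempty B] :
    Function.Surjective (toPrismGroup (B := B)) := by
  obtain ⟨b⟩ := hB
  intro n
  refine ⟨factorGen none ^ n.toAdd.1.val * factorGen (some b) ^ n.toAdd.2.val, ?_⟩
  rw [map_mul, map_pow, map_pow, toPrismGroup_none, toPrismGroup_some]
  revert n
  decide

theorem exists_isRegularCovering_prism [Nonempty B] :
    ∃ p : Hom (triangleTree B) (prism B), p.IsRegularCovering :=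
  ⟨_, cayleyMap_isRegularCovering _ _ toPrismGroup_surjective⟩

/-- A bridge is extended by any frame that contains the reverse of its image: no choice has to agree
with any other, since the group is a free product. -/
theorem Framing.exists_isCovering_triangleTree {Z : SerreGraph} {F : Type} [Countable F]
    [hF : Nonempty F] (P : Framing Z (Bool ⊕ B) F) (hZ : Z.IsConnected) {rot : Perm F}
    (hrot : rot ^ 3 = 1)
    (hinv : ∀ x, Z.inv (P.edge x (.inl false)) = P.edge (rot x) (.inl true))
    (hbridge : ∀ b, Function.Surjective fun x => P.edge x (.inr b)) :
    ∃ p : Hom (triangleTree B) Z, p.IsCovering := by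
  obtain ⟨x₀⟩ := hF
  choose σ σ_sq σ_edge using fun b => exists_involution_lift (hbridge b) Z.inv_inv
  let rotCopies : Perm (F × ℕ) := rot.prodCongr (Equiv.refl ℕ)
  have rotCopies_cube : rotCopies ^ 3 = 1 :=
    Equiv.ext fun x => Prod.ext (Equiv.congr_fun hrot x.1) rfl
  obtain ⟨φ, hφ⟩ : ∃ φ : TriangleGroup B →* Perm (F × ℕ),
      ∀ i, φ (factorGen i) = i.elim rotCopies σ :=
    exists_hom_coprodI_zmod (by rintro (_ | b); exacts [rotCopies_cube, σ_sq b])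
  refine (P.comap Prod.fst).exists_isCovering_cayley hZ _ φ (fun x l => ?_) (x₀, 0)
  rcases l with (_ | _) | b
  · change _ = P.edge (φ (factorGen none) x).1 _
    rw [hφ]
    exact hinv x.1
  · change _ = P.edge (φ (factorGen none)⁻¹ x).1 (.inl false)
    rw [map_inv, hφ, ← Z.inv_inv (P.edge _ (.inl false)), hinv]
    change _ = Z.inv (P.edge (rotCopies (rotCopies.symm x)).1 _)
    rw [apply_symm_apply]
    rfl
  · change _ = P.edge (φ (factorGen (some b)) x).1 _
    rw [hφ]
    exact (σ_edge b x).symm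

end TriangleTree

/-! ### The irregular quotient -/

/-- The inner vertices `(false, ε)` and the outer vertices `(true, ε)` are joined by the spokes
`inr i`.  The edges `inl o` are the two orientations of the loop at an inner vertex, and the two
edges to the other outer vertex at an outer one. -/
abbrev twinGraph : SerreGraph where
  V := Bool × Bool
  D := (Bool × Bool) × (Bool ⊕ Fin 3)
  src := Prod.fst
  inv
    | ((false, ε), .inl o) => ((false, ε), .inl !o)
    | ((true, ε), .inl o) => ((true, !ε), .inl o)
    | ((k, ε), .inr i) => ((!k, ε), .inr i)
  inv_inv := by decide
  inv_ne := by decide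

theorem twinGraph_isFinite : twinGraph.IsFinite :=
  ⟨inferInstanceAs (Finite (Bool × Bool)),
    inferInstanceAs (Finite ((Bool × Bool) × (Bool ⊕ Fin 3)))⟩

theorem twinGraph_isConnected : twinGraph.IsConnected := by
  refine (SimpleGraph.connected_iff_exists_forall_reachable _).2 ⟨(true, false), ?_⟩
  have outer : ∀ ε, twinGraph.toSimpleGraph.Reachable (true, false) (true, ε)
    | false => .rfl
    | true => reachable_src_tgt (X := twinGraph) ((true, false), .inl false)
  rintro ⟨_ | _, ε⟩
  · exact (outer ε).trans (reachable_src_tgt (X := twinGraph) ((true, ε), .inr 0))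
  · exact outer ε

theorem twinGraph_xor_src_tgt : ∀ d : twinGraph.D,
    ((twinGraph.src d).2 ^^ (twinGraph.tgt d).2) =
      ((twinGraph.src d).1 && (twinGraph.tgt d).1) := by
  decide

/-- The label in `twinGraph` of the edge that a frame matches with a label of the tree of triangles.
Every triangle is mapped to the closed walk from an outer vertex along the spoke `r`, around the
loop, and back along the spoke `r + 1`.  A frame is given by `(j, r, c)` and the side `ε` of
`twinGraph`, where `j` is the position on this walk, starting at the outer vertex, and `c` is a
cyclic shift of the bridges. -/
def twinLabel (j r c : Fin 3) : Bool ⊕ Fin 3 → Bool ⊕ Fin 3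
  | .inl false => ![.inr r, .inl false, .inr (r + 1)] j
  | .inl true => ![.inr (r + 1), .inr r, .inl true] j
  | .inr i => ![![.inl false, .inl true, .inr (r + 2)],
      ![.inl true, .inr (r + 1), .inr (r + 2)],
      ![.inl false, .inr r, .inr (r + 2)]] j (i + c)

theorem twinLabel_injective : ∀ j r c : Fin 3, Function.Injective (twinLabel j r c) := by
  decide

/-- The framing of `twinGraph` given by `twinLabel`, with frames `(j, r, c, ε)`. -/
def twinFraming : Framing twinGraph (Bool ⊕ Fin 3) (Fin 3 × Fin 3 × Fin 3 × Bool) where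
  vertex x := (x.1 = 0, x.2.2.2)
  edge x l := ((x.1 = 0, x.2.2.2), twinLabel x.1 x.2.1 x.2.2.1 l)
  bijOn_edge x := by
    have hx := twinLabel_injective x.1 x.2.1 x.2.2.1
    refine ⟨fun _ _ => rfl, fun l _ l' _ h => hx (Prod.ext_iff.1 h).2, ?_⟩
    rintro ⟨_, m⟩ rfl
    obtain ⟨l, rfl⟩ := Finite.surjective_of_injective hx m
    exact ⟨l, Set.mem_univ l, rfl⟩

theorem exists_isCovering_twinGraph : ∃ p : Hom (triangleTree (Fin 3)) twinGraph, p.IsCovering := by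
  refine twinFraming.exists_isCovering_triangleTree twinGraph_isConnected
    (rot := (Equiv.addRight (1 : Fin 3)).prodCongr (Equiv.refl _)) ?_ ?_ ?_
  · decide
  · decide
  · decide

/-! ### The obstruction -/

section Obstruction

theorem eq_inl_of_toPrismGroup_eq_one {B : Type} : ∀ l₁ l₂ l₃ : Bool ⊕ B,
    toPrismGroup (triangleElt l₃) * (toPrismGroup (triangleElt l₂) * toPrismGroup (triangleElt l₁))
      = 1 → ∃ o, l₁ = .inl o ∧ l₂ = .inl o ∧ l₃ = .inl o := by
  simp only [toPrismGroup_triangleElt]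
  rintro ((_ | _) | _) ((_ | _) | _) ((_ | _) | _) h <;>
  first
  | exact ⟨_, rfl, rfl, rfl⟩
  | exact absurd h (by simp only [Sum.elim_inl, Sum.elim_inr]; decide)

variable {Y : SerreGraph}

theorem Hom.eq_inl_of_closed_walk {B : Type} (q : Hom Y (prism B)) {e₁ e₂ e₃ : Y.D}
    (h₁ : Y.tgt e₁ = Y.src e₂) (h₂ : Y.tgt e₂ = Y.src e₃) (h₃ : Y.tgt e₃ = Y.src e₁) :
    ∃ o, (q.onD e₁).2 = .inl o ∧ (q.onD e₂).2 = .inl o ∧ (q.onD e₃).2 = .inl o := by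
  have onV_tgt (e) : q.onV (Y.tgt e) =
      toPrismGroup (triangleElt (q.onD e).2) * q.onV (Y.src e) := by
    rw [← q.tgt_onD, ← q.src_onD]
    rfl
  refine eq_inl_of_toPrismGroup_eq_one _ _ _ (mul_eq_right (b := q.onV (Y.src e₁)).1 ?_)
  rw [mul_assoc, mul_assoc, ← onV_tgt, h₁, ← onV_tgt, h₂, ← onV_tgt, h₃]

theorem Hom.exists_closed_walk {B : Type} (p : Hom (triangleTree B) Y) (g : TriangleGroup B) :
    ∃ e₁ e₂ e₃, Y.src e₁ = p.onV g ∧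
      Y.tgt e₁ = Y.src e₂ ∧ Y.tgt e₂ = Y.src e₃ ∧ Y.tgt e₃ = Y.src e₁ := by
  let edge (g : TriangleGroup B) : Y.D := p.onD (g, .inl false)
  have src_edge (g) : Y.src (edge g) = p.onV g := p.src_onD _
  have tgt_edge (g) : Y.tgt (edge g) = Y.src (edge (factorGen none * g)) :=
    (p.tgt_onD _).trans (src_edge _).symm
  have hcube : (factorGen none : TriangleGroup B) ^ 3 = 1 := factorGen_pow none
  refine ⟨edge g, edge (factorGen none * g), edge (factorGen none * (factorGen none * g)),
    src_edge g, tgt_edge _, tgt_edge _, ?_⟩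
  rw [tgt_edge, ← mul_assoc, ← mul_assoc, ← pow_three', hcube, one_mul]

/-- The triangles of the tree map to closed walks in `Y`, on which the lifted edges of the triangles
of the prism have to be followed, in one direction or the other. -/
theorem exists_rotation_of_covers_prism {B : Type} {p : Hom (triangleTree B) Y} (hp : p.IsCovering)
    {q : Hom Y (prism B)} (hq : q.IsCovering) :
    ∃ ρ : Perm Y.V, (∀ y, ∃ e, Y.src e = y ∧ Y.tgt e = ρ y) ∧ ∀ y, ρ (ρ (ρ y)) = y := by
  obtain ⟨ρ, hρ⟩ := hq.exists_perm_lift (δ := fun g => (g, .inl false)) (fun _ => rfl)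
    (Group.mulLeft_bijective (toPrismGroup (triangleElt (.inl false))))
  have along (e) (he : (q.onD e).2 = .inl false) : ρ (Y.src e) = Y.tgt e :=
    hρ e (Prod.ext (q.src_onD e) he)
  have against (e) (he : (q.onD e).2 = .inl true) : ρ (Y.tgt e) = Y.src e := by
    have hinv : (q.onD (Y.inv e)).2 = .inl false := by
      rw [← q.inv_onD]
      exact congrArg (Sum.map not id) he
    simpa only [tgt, Y.inv_inv] using along (Y.inv e) hinv
  refine ⟨ρ, fun y => ?_, fun y => ?_⟩
  · have hstar : (q.onV y, .inl false) ∈ (prism B).star (q.onV y) := rfl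
    obtain ⟨e, rfl, he⟩ := (hq.2 y).surjOn hstar
    exact ⟨e, rfl, (along e (congrArg Prod.snd he)).symm⟩
  · obtain ⟨g, rfl⟩ := hp.1 y
    obtain ⟨e₁, e₂, e₃, hg, h₁, h₂, h₃⟩ := p.exists_closed_walk g
    obtain ⟨_ | _, l₁, l₂, l₃⟩ := q.eq_inl_of_closed_walk h₁ h₂ h₃
    · rw [← hg, along _ l₁, h₁, along _ l₂, h₂, along _ l₃, h₃]
    · rw [← hg, ← h₃, against _ l₃, ← h₂, against _ l₂, ← h₁, against _ l₁, h₃]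

theorem two_mul_sum_outer [Fintype Y.V] {q : Hom Y twinGraph} (hq : q.IsCovering) :
    2 * ∑ y, (q.onV y).1.toNat = Fintype.card Y.V := by
  let spoke (v : Bool × Bool) : twinGraph.D := (v, .inr 0)
  obtain ⟨ρ, hρ⟩ := hq.exists_perm_lift (δ := spoke) (fun _ => rfl) (by decide)
  have outer_add (y) : (q.onV y).1.toNat + (q.onV (ρ y)).1.toNat = 1 := by
    have hstar : spoke (q.onV y) ∈ twinGraph.star (q.onV y) := rfl
    obtain ⟨e, rfl, he⟩ := (hq.2 y).surjOn hstar
    rw [hρ e he, ← q.tgt_onD, he]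
    generalize q.onV (Y.src e) = v
    revert v
    decide
  calc 2 * ∑ y, (q.onV y).1.toNat
      = ∑ y, (q.onV y).1.toNat + ∑ y, (q.onV (ρ y)).1.toNat := by
        rw [two_mul, Equiv.sum_comp ρ fun y => (q.onV y).1.toNat]
    _ = Fintype.card Y.V := by
        rw [← Finset.sum_add_distrib, Finset.sum_congr rfl fun y _ => outer_add y,
          Fintype.card_eq_sum_ones]

theorem outer_add_outer_add_outer_le_one : ∀ {u v w : Bool × Bool},
    (u.2 ^^ v.2) = (u.1 && v.1) → (v.2 ^^ w.2) = (v.1 && w.1) → (w.2 ^^ u.2) = (w.1 && u.1) →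
      u.1.toNat + v.1.toNat + w.1.toNat ≤ 1 := by
  decide

theorem three_mul_sum_outer_le [Fintype Y.V] (q : Hom Y twinGraph) {ρ : Perm Y.V}
    (hedge : ∀ y, ∃ e, Y.src e = y ∧ Y.tgt e = ρ y) (hcube : ∀ y, ρ (ρ (ρ y)) = y) :
    3 * ∑ y, (q.onV y).1.toNat ≤ Fintype.card Y.V := by
  let outer (y : Y.V) : ℕ := (q.onV y).1.toNat
  have xor_eq (y) : ((q.onV y).2 ^^ (q.onV (ρ y)).2) = ((q.onV y).1 && (q.onV (ρ y)).1) := by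
    obtain ⟨e, rfl, he⟩ := hedge y
    rw [← he, ← q.src_onD, ← q.tgt_onD]
    exact twinGraph_xor_src_tgt _
  have sum_le_one (y) : outer y + outer (ρ y) + outer (ρ (ρ y)) ≤ 1 :=
    outer_add_outer_add_outer_le_one (xor_eq y) (xor_eq (ρ y)) (by
      simpa only [hcube] using xor_eq (ρ (ρ y)))
  calc 3 * ∑ y, outer y
      = ∑ y, outer y + ∑ y, outer (ρ y) + ∑ y, outer (ρ (ρ y)) := by
        rw [Equiv.sum_comp ρ fun y => outer (ρ y), Equiv.sum_comp ρ outer]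
        ring
    _ = ∑ y, (outer y + outer (ρ y) + outer (ρ (ρ y))) := by
        rw [Finset.sum_add_distrib, Finset.sum_add_distrib]
    _ ≤ ∑ _y : Y.V, 1 := Finset.sum_le_sum fun y _ => sum_le_one y
    _ = Fintype.card Y.V := Fintype.card_eq_sum_ones.symm

theorem infinite_of_covers_prism_of_covers_twinGraph {B : Type} (hX : (triangleTree B).Covers Y)
    (h₁ : Y.Covers twinGraph) (h₂ : Y.Covers (prism B)) : Infinite Y.V := by
  obtain ⟨p, hp⟩ := hX
  obtain ⟨q₁, hq₁⟩ := h₁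
  obtain ⟨q₂, hq₂⟩ := h₂
  by_contra hfin
  rw [not_infinite_iff_finite] at hfin
  have := Fintype.ofFinite Y.V
  have : Nonempty Y.V := ⟨p.onV (1 : TriangleGroup B)⟩
  obtain ⟨ρ, hedge, hcube⟩ := exists_rotation_of_covers_prism hp hq₂
  have half := two_mul_sum_outer hq₁
  have third := three_mul_sum_outer_le q₁ hedge hcube
  have hpos : 0 < Fintype.card Y.V := Fintype.card_pos
  omega

end Obstruction

end SerreGraph

open SerreGraph

theorem theorem1p3 :
    ∃ X X₁ X₂ : SerreGraph,
      X.IsLocallyFinite ∧ X.IsQuasitree ∧ X₁.IsFinite ∧ X₂.IsFinite ∧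
      (∃ p₁ : SerreGraph.Hom X X₁, p₁.IsCovering) ∧
      (∃ p₂ : SerreGraph.Hom X X₂, p₂.IsRegularCovering) ∧
      (∃ Γ : Subgroup X.Aut, X.IsUniformLattice Γ) ∧
      ¬ ∃ Y : SerreGraph, Y.IsFinite ∧ X.Covers Y ∧ Y.Covers X₁ ∧ Y.Covers X₂ := by
  refine ⟨triangleTree (Fin 3), twinGraph, prism (Fin 3), cayley_isLocallyFinite _,
    triangleTree_isQuasitree, twinGraph_isFinite, cayley_isFinite _, exists_isCovering_twinGraph,
    exists_isRegularCovering_prism, ⟨_, cayleyAction_isUniformLattice _⟩, ?_⟩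
  rintro ⟨Y, hY, hX, h₁, h₂⟩
  have := infinite_of_covers_prism_of_covers_twinGraph hX h₁ h₂
  exact not_finite_iff_infinite.2 this hY.1
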